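/- All rings are commutative. Let $A$ be a commutative ring. A module $M$ *admits a finite free resolution* if for some $n\ge 0$ there is an exact sequence $0\to L_n\to\cdots\to L_0\to M\to 0$ with every $L_i\cong A^{p_i}$ free of finite rank. For a finitely generated ideal $\mathfrak b$, $\mathrm{Gr}(\mathfrak b)\ge 2$ means: if $f_1,f_2$ are polynomials over $A$ in disjoint sets of indeterminates, both having $\mathfrak b$ as the ideal generated by their coefficients, then $f_1$ is a nonzerodivisor in the polynomial ring $A[\underline X]$ in all these indeterminates, and $f_2$ is a nonzerodivisor modulo $f_1$ (the quotient $A[\underline X]/\langle f_1,f_2\rangle$ may be zero); this does not depend on the choice of $f_1,f_2$. 1. Let $\mathfrak a=\langle a_1,a_2\rangle$ be a nonzero ideal of $A$. The following are equivalent: (a) $\mathfrak a$ has a greatest common divisor $g$ (a common divisor of $a_1,a_2$ that every common divisor of $a_1,a_2$ divides) that is a nonzerodivisor of $A$ and satisfies $\mathrm{Gr}(\mathfrak a/g)\ge 2$, where $\mathfrak a/g=\langle a_1/g,a_2/g\rangle$; (b) the $A$-module $\mathfrak a$ admits a finite free resolution; (c) $\mathfrak a$ is faithful (its annihilator is $0$)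 and there are $b_1,b_2\in A$ for which the sequence $$0\longrightarrow A\xrightarrow{\ {}^{t}[\,b_1\ b_2\,]\ }A^2\xrightarrow{\ [\,a_1\ a_2\,]\ }\langle a_1,a_2\rangle\longrightarrow 0$$ is exact. 2. The following are equivalent: (a) every ideal of $A$ generated by two elements admits a finite free resolution; (b) $A$ is an integral gcd ring: every element of $A$ is zero or a nonzerodivisor, and any two elements of $A$ have a greatest common divisor. (The zero ring is allowed.) -/

import Mathlib

/-- `f₁, …, f_k` is a Kronecker sequence of length `k` attached to the ideal `𝔞`: polynomials over
`A` that use pairwise disjoint sets of indeterminates and all have content ideal `𝔞`. -/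
def IsKroneckerSequence {A : Type*} [CommRing A] (𝔞 : Ideal A) {k : ℕ}
    (f : Fin k → MvPolynomial ℕ A) : Prop :=
  (∀ i, Ideal.span ((f i).coeffs : Set A) = 𝔞) ∧
    ∀ i j, i ≠ j → Disjoint (f i).vars (f j).vars

/-- `Gr_A(𝔞) ≥ k` (Hochster–Northcott true grade): a Kronecker sequence of length `k` attached to
`𝔞` is a regular sequence of the polynomial ring, in the sense that each term is a nonzerodivisor
modulo the previous ones (the last quotient may vanish). -/
def TrueGradeGE {A : Type*} [CommRing A] (𝔞 : Ideal A) (k : ℕ) : Prop :=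
  ∃ f : Fin k → MvPolynomial ℕ A, IsKroneckerSequence 𝔞 f ∧
    RingTheory.Sequence.IsWeaklyRegular (MvPolynomial ℕ A) (List.ofFn f)

/-- `g` is a greatest common divisor of the ideal `𝔞`. -/
def IsIdealGcd {A : Type*} [CommRing A] (𝔞 : Ideal A) (g : A) : Prop :=
  (∀ x ∈ 𝔞, g ∣ x) ∧ ∀ d : A, (∀ x ∈ 𝔞, d ∣ x) → d ∣ g

/-- The ideal `{x | g * x ∈ 𝔞}`. When `g` is a nonzerodivisor that divides `a₁, …, aₙ` and
`𝔞 = ⟨a₁, …, aₙ⟩`, it is the ideal `𝔞/g = ⟨a₁/g, …, aₙ/g⟩`. -/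
def idealDiv {A : Type*} [CommRing A] (𝔞 : Ideal A) (g : A) : Ideal A :=
  Submodule.comap (LinearMap.mulLeft A g) 𝔞

/-- A finite free resolution of length `n` of the module `M`, i.e. an exact sequence
`0 → A ^ r n → ⋯ → A ^ r 1 → A ^ r 0 → M → 0`; it is extended on the left by zero modules. -/
structure FiniteFreeResolution (A : Type*) [CommRing A] (M : Type*) [AddCommGroup M] [Module A M]
    (n : ℕ) where
  r : ℕ → ℕ
  r_eq_zero : ∀ k, n < k → r k = 0
  u : ∀ k, (Fin (r (k + 1)) → A) →ₗ[A] (Fin (r k) → A)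
  π : (Fin (r 0) → A) →ₗ[A] M
  surjective : Function.Surjective π
  exact_zero : Function.Exact (u 0) π
  exact_succ : ∀ k, Function.Exact (u (k + 1)) (u k)

/-- `M` admits a finite free resolution. -/
def IsFreelyResolvable (A : Type*) [CommRing A] (M : Type*) [AddCommGroup M] [Module A M] : Prop :=
  ∃ n : ℕ, Nonempty (FiniteFreeResolution A M n)

/-- The map `A → A²` with matrix the column `[b₁ b₂]ᵀ`, `t ↦ (t b₁, t b₂)`. -/
def columnMap {A : Type*} [CommRing A] (b₁ b₂ : A) : A →ₗ[A] (Fin 2 → A) :=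
  LinearMap.toSpanSingleton A (Fin 2 → A) ![b₁, b₂]

/-- The map `A² → ⟨a₁, a₂⟩` with matrix the row `[a₁ a₂]`, `v ↦ v₀ a₁ + v₁ a₂`. -/
def rowMap {A : Type*} [CommRing A] (a₁ a₂ : A) :
    (Fin 2 → A) →ₗ[A] (Ideal.span {a₁, a₂} : Ideal A) :=
  LinearMap.codRestrict (Ideal.span {a₁, a₂} : Ideal A) (Fintype.linearCombination A ![a₁, a₂])
    fun v => Ideal.mem_span_pair.2 ⟨v 0, v 1, by
      simp [Fintype.linearCombination_apply, Fin.sum_univ_two]⟩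

/-- An integral gcd ring: every element is zero or a nonzerodivisor, and any two elements have a
greatest common divisor. The zero ring is not excluded. -/
def IsIntegralGcdRing (A : Type*) [CommRing A] : Prop :=
  (∀ a : A, a = 0 ∨ a ∈ nonZeroDivisors A) ∧
    ∀ a b : A, ∃ g : A, g ∣ a ∧ g ∣ b ∧ ∀ d : A, d ∣ a → d ∣ b → d ∣ g

/-! Grade at least two is used in an elementary form, `GradeTwo`, which passes to larger ideals and
to products and, for finitely generated ideals, to powers of the generators. Each map `u` of a
finite free resolution has a volume form `ω`, the determinant of its image. At the zero module on
the left it is the constant 1. The formula `det (u x, y) = ω' y * ω x` then produces the form `ω'`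
of the next map (`IsVolumeForm.exists_next`): the division by `ω` is possible because alternating
forms on the image are multiples of `ω` (`exists_eq_smul`), and the values of `ω'` have grade two
because the minors of `u` do (`minor_gradeTwo`). On reaching a nonzero ideal `I`, the form has
degree one, and Cramer's rule makes the augmentation onto `I` proportional to `ω`, hence equal to `g
* ω`: thus `I` is `g` times an ideal of grade two. For two generators this reads `aᵢ = g * bᵢ` with
`![b₁, b₂]` of grade two. The syzygies are then the multiples of `(b₂, -b₁)`, and `g` is a gcd.
Kronecker sequences identify `GradeTwo` with the true grade, and in a gcd domain Euclid's lemma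
gives the same factorization. -/

open Function

/-- The family `f` generates an ideal of grade at least two: it has no nonzero annihilator, and
every family proportional to `f` is a multiple of `f`. -/
def GradeTwo {A : Type*} [CommRing A] {ι : Type*} (f : ι → A) : Prop :=
  (∀ a, (∀ i, a * f i = 0) → a = 0) ∧
    ∀ g : ι → A, (∀ i j, f i * g j = f j * g i) → ∃ c, ∀ i, g i = c * f i

/-! ### Stability of grade two. -/

namespace GradeTwo

variable {A : Type*} [CommRing A] {ι κ : Type*} {f : ι → A} {f' : κ → A}

theorem eq_of_mul_eq (hf : GradeTwo f) {a b : A} (h : ∀ i, a * f i = b * f i) : a = b :=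
  sub_eq_zero.1 (hf.1 _ fun i => by rw [sub_mul, h, sub_self])

theorem mono (hf : GradeTwo f) (h : ∀ i, f i ∈ Ideal.span (Set.range f')) : GradeTwo f' := by
  have h1 : ∀ a, (∀ i, a * f' i = 0) → a = 0 := by
    intro a ha
    refine hf.1 a fun i => ?_
    have : Ideal.span (Set.range f') ≤ Submodule.comap (LinearMap.mulLeft A a) ⊥ :=
      Ideal.span_le.2 (by rintro _ ⟨k, rfl⟩; simpa using ha k)
    simpa using this (h i)
  refine ⟨h1, fun g hg => ?_⟩
  -- If `g = c * f'`, then `y` is `c * x`: the unknown ratio `c` acts on the whole ideal.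
  have h2 : ∀ x ∈ Ideal.span (Set.range f'), ∃ y, ∀ k, f' k * y = x * g k := by
    intro x hx
    induction hx using Submodule.span_induction with
    | mem x hx =>
      obtain ⟨l, rfl⟩ := hx
      exact ⟨g l, fun k => hg k l⟩
    | zero => exact ⟨0, by simp⟩
    | add x x' _ _ hx hx' =>
      obtain ⟨y, hy⟩ := hx
      obtain ⟨y', hy'⟩ := hx'
      exact ⟨y + y', fun k => by rw [mul_add, hy, hy', add_mul]⟩
    | smul a x _ hx =>
      obtain ⟨y, hy⟩ := hx
      exact ⟨a * y, fun k => by rw [mul_left_comm, hy, smul_eq_mul, mul_assoc]⟩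
  choose y hy using fun i => h2 _ (h i)
  obtain ⟨c, hc⟩ := hf.2 y fun i j => sub_eq_zero.1 <| h1 _ fun k => by
    linear_combination f i * hy j k - f j * hy i k
  refine ⟨c, fun k => hf.eq_of_mul_eq fun i => ?_⟩
  linear_combination f' k * hc i - hy i k

/-- For fixed `j` the slice `g (·, j)` is proportional to `f`, so it is `c j * f`; the resulting
family `c` is proportional to `f'`. -/
theorem mul (hf : GradeTwo f) (hf' : GradeTwo f') :
    GradeTwo fun p : ι × κ => f p.1 * f' p.2 := by
  have h1 : ∀ a, (∀ i j, a * (f i * f' j) = 0) → a = 0 := fun a ha =>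
    hf.1 a fun i => hf'.1 _ fun j => by rw [mul_assoc, ha]
  refine ⟨fun a ha => h1 a fun i j => ha (i, j), fun g hg => ?_⟩
  have h2 : ∀ j, ∃ c, ∀ i, g (i, j) = c * f i := fun j => by
    refine hf.2 (fun i => g (i, j)) fun i k => sub_eq_zero.1 <| h1 _ fun a b => ?_
    have e1 := hg (a, b) (k, j)
    have e2 := hg (a, b) (i, j)
    dsimp only at e1 e2
    linear_combination f i * e1 - f k * e2
  choose c hc using h2
  obtain ⟨d, hd⟩ := hf'.2 c fun j l => hf.eq_of_mul_eq fun i => hf.eq_of_mul_eq fun k => by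
    have e := hg (k, j) (i, l)
    dsimp only at e
    rw [hc, hc] at e
    linear_combination e
  exact ⟨d, fun p => by rw [show p = (p.1, p.2) from rfl, hc, hd]; ring⟩

theorem ideal_pow {I : Ideal A} (hI : GradeTwo ((↑) : I → A)) :
    ∀ n : ℕ, GradeTwo ((↑) : ((I ^ n : Ideal A)) → A)
  | 0 => by
    refine ⟨fun a ha => by simpa using ha ⟨1, by simp⟩, fun g hg => ⟨g ⟨1, by simp⟩, fun i => ?_⟩⟩
    simpa [mul_comm] using hg ⟨1, by simp⟩ i
  | n + 1 => by
    refine ((ideal_pow hI n).mul hI).mono fun p => ?_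
    rw [Subtype.range_coe]
    exact Ideal.subset_span (by
      rw [pow_succ]; exact Ideal.mul_mem_mul p.1.2 p.2.2)

/-- Some power of the finitely generated ideal of `f` lies in the ideal of the `f i ^ n`. -/
theorem pow (hf : GradeTwo f) (hfg : (Ideal.span (Set.range f)).FG) (n : ℕ) :
    GradeTwo fun i => f i ^ n := by
  have h1 : GradeTwo ((↑) : Ideal.span (Set.range f) → A) := by
    refine hf.mono fun i => ?_
    rw [Subtype.range_coe]
    exact Ideal.subset_span (Ideal.subset_span ⟨i, rfl⟩)
  obtain ⟨m, hm⟩ := Ideal.exists_pow_le_of_le_radical_of_fg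
    (I := Ideal.span (Set.range f)) (J := Ideal.span (Set.range fun i => f i ^ n))
    (Ideal.span_le.2 (by
      rintro _ ⟨i, rfl⟩
      exact ⟨n, Ideal.subset_span ⟨i, rfl⟩⟩)) hfg
  exact (h1.ideal_pow m).mono fun x => hm x.2

end GradeTwo

/-! ### Alternating forms that factor through an image. -/

namespace AlternatingMap

variable {A M : Type*} [CommRing A] [AddCommGroup M] [Module A M]

/-- Expand `β (y + (x - y))`: every term but `β y` has an argument in the kernel of `u`. -/
theorem congr_of_map_eq_zero {N P : Type*} [AddCommGroup N] [Module A N]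
    [AddCommGroup P] [Module A P] {ι : Type*} [Fintype ι] [DecidableEq ι] {u : M →ₗ[A] N}
    (β : M [⋀^ι]→ₗ[A] P) (hβ : ∀ x i, u (x i) = 0 → β x = 0) {x y : ι → M}
    (h : ∀ i, u (x i) = u (y i)) : β x = β y := by
  have e : x = y + (x - y) := by simp
  have := β.toMultilinearMap.map_add_univ y (x - y)
  rw [← e, Finset.sum_eq_single Finset.univ] at this
  · simpa using this
  · intro s _ hs
    obtain ⟨i, hi⟩ : ∃ i, i ∉ s := by
      by_contra! H
      exact hs (Finset.eq_univ_iff_forall.2 H)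
    exact hβ _ i (by simp [hi, h])
  · simp

theorem span_range_fg {m r : ℕ} (ω : (Fin m → A) [⋀^Fin r]→ₗ[A] A) :
    (Ideal.span (Set.range ω)).FG := by
  set e := Pi.basisFun A (Fin m)
  set I := Ideal.span (Set.range fun J : Fin r → Fin m => ω fun i => e (J i))
  have hI : (Submodule.mkQ I).compAlternatingMap ω = 0 :=
    e.ext_alternating fun J _ => by
      exact Ideal.Quotient.eq_zero_iff_mem.2 (Ideal.subset_span (Set.mem_range_self J))
  have : Ideal.span (Set.range ω) = I := by
    refine le_antisymm (Ideal.span_le.2 ?_) (Ideal.span_mono ?_)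
    · rintro _ ⟨x, rfl⟩
      exact Ideal.Quotient.eq_zero_iff_mem.1 (DFunLike.congr_fun hI x)
    · rintro _ ⟨J, rfl⟩
      exact ⟨_, rfl⟩
  rw [this]
  exact Submodule.fg_span (Set.finite_range _)

end AlternatingMap

/-- A volume form of degree `r` on the image of `u`: an alternating form on the
source of `u` that factors through the image of `u`, satisfies Cramer's rule there, and whose values
generate an ideal of grade at least two. -/
structure IsVolumeForm {A : Type*} [CommRing A] {m p r : ℕ}
    (u : (Fin m → A) →ₗ[A] (Fin p → A)) (ω : (Fin m → A) [⋀^Fin r]→ₗ[A] A) : Prop where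
  map_eq_zero : ∀ x i, u (x i) = 0 → ω x = 0
  cramer : ∀ z w, ω z • u w = ∑ i, ω (update z i w) • u (z i)
  gradeTwo : GradeTwo ω

/-! ### Minors and Laplace expansion. -/

section Minors

variable {A : Type*} [CommRing A] {m p r t : ℕ}

/-- The minor of `u` on the rows `I` at the vectors `z`. -/
def imageMinor (u : (Fin m → A) →ₗ[A] (Fin p → A)) (z : Fin r → Fin m → A) (I : Fin r → Fin p) : A :=
  (Matrix.of fun a b => u (z b) (I a)).det

/-- The vector `w` is the cofactor combination of `z j` and the `z (J b)`. Applying `u` gives the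
expansion along the first row, while putting `w` in slot `j` of `ω` repeats an argument in every
term except that of `z j`. -/
theorem exists_laplace (u : (Fin m → A) →ₗ[A] (Fin p → A)) (z : Fin r → Fin m → A)
    (J : Fin t → Fin r) {j : Fin r} (hj : j ∉ Set.range J) (I : Fin t → Fin p) :
    ∃ w, (∀ l, u w l = imageMinor u (z ∘ Fin.cons j J) (Fin.cons l I : Fin (t + 1) → Fin p)) ∧
      ∀ ω : (Fin m → A) [⋀^Fin r]→ₗ[A] A, ω (update z j w) = imageMinor u (z ∘ J) I * ω z := by
  refine ⟨∑ b : Fin (t + 1), ((-1) ^ (b : ℕ) * imageMinor u ((z ∘ Fin.cons j J) ∘ b.succAbove) I) •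
    z ((Fin.cons j J : Fin (t + 1) → Fin r) b), fun l => ?_, fun ω => ?_⟩
  · rw [imageMinor, Matrix.det_succ_row_zero]
    simp only [map_sum, map_smul, Finset.sum_apply, Pi.smul_apply, smul_eq_mul]
    refine Finset.sum_congr rfl fun b _ => ?_
    rw [mul_right_comm]
    rfl
  · rw [AlternatingMap.map_update_sum, Fin.sum_univ_succ, Finset.sum_eq_zero]
    · have : (z ∘ (Fin.cons j J : Fin (t + 1) → Fin r)) ∘ Fin.succ = z ∘ J := by
        ext; simp
      simp [AlternatingMap.map_update_smul, this]
    · intro b _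
      rw [AlternatingMap.map_update_smul, Fin.cons_succ,
        ω.map_update_self z fun h => hj ⟨b, h.symm⟩, smul_zero]

end Minors

/-! ### Uniqueness of volume forms and the grade of the minors. -/

namespace IsVolumeForm

variable {A : Type*} [CommRing A] {m p q r s : ℕ} {u : (Fin m → A) →ₗ[A] (Fin p → A)}
  {ω : (Fin m → A) [⋀^Fin r]→ₗ[A] A}

theorem gradeTwo_pow (h : IsVolumeForm u ω) (n : ℕ) : GradeTwo fun x => ω x ^ n :=
  h.gradeTwo.pow ω.span_range_fg n

/-- Pulled back along `z`, the form `β` is `β z` times a determinant, so it vanishes on combinations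
of `z`. By Cramer's rule each `ω z • y j` is such a combination modulo the kernel of `u`; the `r`
slots account for the power. -/
theorem pow_mul_eq_zero (h : IsVolumeForm u ω) (β : (Fin m → A) [⋀^Fin r]→ₗ[A] A)
    (hβ : ∀ x i, u (x i) = 0 → β x = 0) (z : Fin r → Fin m → A) (hz : β z = 0)
    (y : Fin r → Fin m → A) : ω z ^ r * β y = 0 := by
  have h1 : β.compLinearMap (Fintype.linearCombination A z) = 0 := by
    rw [AlternatingMap.eq_smul_basis_det (Pi.basisFun A (Fin r))
      (β.compLinearMap (Fintype.linearCombination A z))]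
    have : (β.compLinearMap (Fintype.linearCombination A z)) (Pi.basisFun A (Fin r)) = 0 := by
      rw [AlternatingMap.compLinearMap_apply, ← hz]
      congr 1
      ext i : 1
      simp
    rw [this, zero_smul]
  have h2 : β (fun j => ω z • y j) =
      β fun j => Fintype.linearCombination A z fun i => ω (update z i (y j)) :=
    β.congr_of_map_eq_zero hβ fun j => by
      rw [map_smul, h.cramer, Fintype.linearCombination_apply, map_sum]
      simp only [map_smul]
  have h3 := β.toMultilinearMap.map_smul_univ (fun _ => ω z) y
  have h4 := DFunLike.congr_fun h1 fun j i => ω (update z i (y j))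
  simp only [AlternatingMap.coe_multilinearMap, Finset.prod_const, Finset.card_univ,
    Fintype.card_fin, smul_eq_mul] at h3
  rw [← h3, h2]
  exact h4

theorem exists_eq_smul (h : IsVolumeForm u ω) (ψ : (Fin m → A) [⋀^Fin r]→ₗ[A] A)
    (hψ : ∀ x i, u (x i) = 0 → ψ x = 0) : ∃ c, ∀ x, ψ x = c * ω x := by
  -- The form `ω z • ψ - ψ z • ω` vanishes at `z`, which costs a factor `ω z ^ r`; eliminating `ψ z`
  -- between `x` and `y` leaves one more `ω z`.
  refine h.gradeTwo.2 ψ fun x y => sub_eq_zero.1 <| (h.gradeTwo_pow (r + 1)).1 _ fun z => ?_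
  have key : ∀ y, ω z ^ r * (ω z * ψ y - ψ z * ω y) = 0 := fun y => by
    have := h.pow_mul_eq_zero (ω z • ψ - ψ z • ω)
      (fun x i hi => by simp [hψ x i hi, h.map_eq_zero x i hi]) z (by simp [mul_comm]) y
    simpa using this
  linear_combination ω x * key y - ω y * key x

/-- Descending induction on the size of minors: each lost row costs a factor `ω z`. By Laplace
expansion `u` kills the corresponding multiple of `w`, so `ω` vanishes once that multiple is
inserted. The empty minor is 1, which leaves `x * ω z ^ r = 0`. -/
theorem minor_faithful (h : IsVolumeForm u ω) (x : A)
    (hx : ∀ (z : Fin r → Fin m → A) (I : Fin r → Fin p), x * imageMinor u z I = 0) : x = 0 := by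
  have key : ∀ k t, t + k = r → ∀ (z : Fin r → Fin m → A) (J : Fin t → Fin r), Injective J →
      ∀ I : Fin t → Fin p, x * ω z ^ k * imageMinor u (z ∘ J) I = 0 := by
    intro k
    induction k with
    | zero =>
      rintro t rfl z J _ I
      simpa using hx (z ∘ J) I
    | succ k ih =>
      intro t ht z J hJ I
      obtain ⟨j, hj⟩ : ∃ j, j ∉ Set.range J := by
        by_contra! H
        have := Fintype.card_le_of_surjective J H
        simp at this
        omega
      obtain ⟨w, hw, hω⟩ := exists_laplace u z J hj I
      have h1 : u ((x * ω z ^ k) • w) = 0 := by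
        ext l
        rw [map_smul, Pi.smul_apply, hw, smul_eq_mul,
          ih (t + 1) (by omega) z _ (Fin.cons_injective_iff.2 ⟨hj, hJ⟩)]
        rfl
      have h2 := h.map_eq_zero (update z j ((x * ω z ^ k) • w)) j (by simpa using h1)
      rw [AlternatingMap.map_update_smul, hω, smul_eq_mul] at h2
      linear_combination h2
  exact (h.gradeTwo_pow r).1 x fun z => by
    simpa [imageMinor] using key r 0 (zero_add r) z Fin.elim0 (injective_of_subsingleton _) Fin.elim0

/-- The same descent, with "zero" replaced by "a multiple of the family of minors", shows that `ω z
^ r * g` is such a multiple; the coefficients are in turn proportional to `ω z ^ r`. Exactness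
serves to lift the vector of coefficients through `u`. -/
theorem minor_gradeTwo (h : IsVolumeForm u ω) {u' : (Fin p → A) →ₗ[A] (Fin q → A)}
    (hu : Exact u u') :
    GradeTwo fun i : (Fin r → Fin m → A) × (Fin r → Fin p) => imageMinor u i.1 i.2 := by
  have faithful : ∀ x : A, (∀ i : (Fin r → Fin m → A) × (Fin r → Fin p),
      x * imageMinor u i.1 i.2 = 0) → x = 0 := fun x hx => h.minor_faithful x fun z I => hx (z, I)
  refine ⟨faithful, fun g hg => ?_⟩
  have key : ∀ k t, t + k = r → ∀ (z : Fin r → Fin m → A) (J : Fin t → Fin r), Injective J →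
      ∀ I : Fin t → Fin p, ∃ d, ∀ i, ω z ^ k * imageMinor u (z ∘ J) I * g i = d * imageMinor u i.1 i.2 := by
    intro k
    induction k with
    | zero =>
      rintro t rfl z J _ I
      refine ⟨g (z ∘ J, I), fun i => ?_⟩
      have := hg (z ∘ J, I) i
      dsimp only at this
      linear_combination this
    | succ k ih =>
      intro t ht z J hJ I
      obtain ⟨j, hj⟩ : ∃ j, j ∉ Set.range J := by
        by_contra! H
        have := Fintype.card_le_of_surjective J H
        simp at this
        omega
      obtain ⟨w, hw, hω⟩ := exists_laplace u z J hj I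
      choose d hd using fun l =>
        ih (t + 1) (by omega) z _ (Fin.cons_injective_iff.2 ⟨hj, hJ⟩) (Fin.cons l I)
      have h1 : ∀ i, imageMinor u i.1 i.2 • d = u ((ω z ^ k * g i) • w) := fun i => by
        ext l
        rw [map_smul, Pi.smul_apply, Pi.smul_apply, hw, smul_eq_mul, smul_eq_mul]
        linear_combination -hd l i
      -- Every maximal minor times `d` lies in the image of `u`, and these minors have no common
      -- annihilator.
      have h2 : u' d = 0 := by
        ext l
        refine faithful _ fun i => ?_
        have := congrFun (congrArg u' (h1 i)) l
        rw [hu.apply_apply_eq_zero, map_smul] at this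
        simpa [mul_comm] using this
      obtain ⟨d', hd'⟩ := (hu d).1 h2
      refine ⟨ω (update z j d'), fun i => ?_⟩
      have h3 : ω (update z j (imageMinor u i.1 i.2 • d')) = ω (update z j ((ω z ^ k * g i) • w)) := by
        refine ω.congr_of_map_eq_zero h.map_eq_zero fun l => ?_
        rcases eq_or_ne l j with rfl | hl
        · simp only [update_self]
          rw [map_smul, hd', h1]
        · simp only [update_of_ne hl]
      rw [AlternatingMap.map_update_smul, AlternatingMap.map_update_smul, hω, smul_eq_mul,
        smul_eq_mul] at h3
      linear_combination -h3
  choose d hd using fun z => key r 0 (zero_add r) z Fin.elim0 (injective_of_subsingleton _) Fin.elim0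
  have hd : ∀ z i, ω z ^ r * g i = d z * imageMinor u i.1 i.2 := fun z i => by
    simpa [imageMinor] using hd z i
  obtain ⟨c, hc⟩ := (h.gradeTwo_pow r).2 d fun z z' => sub_eq_zero.1 <| faithful _ fun i => by
    linear_combination ω z' ^ r * hd z i - ω z ^ r * hd z' i
  refine ⟨c, fun i => (h.gradeTwo_pow r).eq_of_mul_eq fun z => ?_⟩
  linear_combination hd z i + imageMinor u i.1 i.2 * hc z

end IsVolumeForm

namespace AlternatingMap

variable {A M : Type*} [CommRing A] [AddCommGroup M] [Module A M] {ι κ : Type*}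

/-- Fix the arguments of an alternating form that are indexed by `κ`. -/
def fixRight (D : M [⋀^ι ⊕ κ]→ₗ[A] A) (y : κ → M) : M [⋀^ι]→ₗ[A] A where
  toFun x := D (Sum.elim x y)
  map_update_add' {_} x i a b := by
    let := Classical.decEq κ
    have := D.map_update_add (Sum.elim x y) (Sum.inl i) a b
    simpa only [Sum.update_elim_inl] using this
  map_update_smul' {_} x i a b := by
    let := Classical.decEq κ
    have := D.map_update_smul (Sum.elim x y) (Sum.inl i) a b
    simpa only [Sum.update_elim_inl] using this
  map_eq_zero_of_eq' x i j h hij :=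
    D.map_eq_zero_of_eq _ (i := Sum.inl i) (j := Sum.inl j) h (by simpa using hij)

end AlternatingMap

/-! ### From one volume form to the next. -/

section VolumeForm

variable {A : Type*} [CommRing A] {m p q r s : ℕ}

/-- The determinant form on `A ^ p`, its arguments being indexed through `e`. -/
def detForm (A : Type*) [CommRing A] {ι : Type*} [Fintype ι] [DecidableEq ι] {p : ℕ}
    (e : ι ≃ Fin p) : (Fin p → A) [⋀^ι]→ₗ[A] A :=
  Matrix.detRowAlternating.compLinearMap (LinearMap.funLeft A A e)

theorem detForm_apply {ι : Type*} [Fintype ι] [DecidableEq ι] (e : ι ≃ Fin p)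
    (v : ι → Fin p → A) : detForm A e v = (Matrix.of fun b a => v b (e a)).det := rfl

theorem detForm_cramer {ι : Type*} [Fintype ι] [DecidableEq ι] (e : ι ≃ Fin p)
    (v : ι → Fin p → A) (w : Fin p → A) :
    detForm A e v • w = ∑ k, detForm A e (update v k w) • v k := by
  set N : Matrix ι ι A := Matrix.of fun a b => v b (e a) with hN
  have h1 : detForm A e v = N.det := (Matrix.det_transpose N).symm ▸ rfl
  have h2 : ∀ k, detForm A e (update v k w) = N.cramer (fun a => w (e a)) k := fun k => by
    rw [Matrix.cramer_apply, ← Matrix.det_transpose, detForm_apply]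
    congr 1
    ext b a
    rcases eq_or_ne b k with rfl | hb
    · simp
    · simp [hb, hN]
  ext l
  obtain ⟨a, rfl⟩ := e.surjective l
  have h3 := congrFun (Matrix.mulVec_cramer N fun a => w (e a)) a
  simp only [Pi.smul_apply, smul_eq_mul, Finset.sum_apply, h1, h2]
  rw [Pi.smul_apply, smul_eq_mul] at h3
  rw [← h3, Matrix.mulVec, dotProduct]
  exact Finset.sum_congr rfl fun b _ => mul_comm _ _

theorem imageMinor_eq_zero {u : (Fin m → A) →ₗ[A] (Fin p → A)} {z : Fin r → Fin m → A}
    {I : Fin r → Fin p} (hI : ¬ Injective I) : imageMinor u z I = 0 := by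
  obtain ⟨a, b, hab, hne⟩ : ∃ a b, I a = I b ∧ a ≠ b := by
    simpa [Injective] using hI
  exact Matrix.det_zero_of_row_eq hne (by ext; simp [hab])

/-- Complete the chosen columns by the basis vectors outside the rows `I`; the matrix becomes block
triangular, and `c` is the sign of the reordering. -/
theorem exists_detForm_eq (e : Fin r ⊕ Fin s ≃ Fin p) (u : (Fin m → A) →ₗ[A] (Fin p → A))
    (z : Fin r → Fin m → A) {I : Fin r → Fin p} (hI : Injective I) :
    ∃ (c : A) (y : Fin s → Fin p → A),
      imageMinor u z I = c * detForm A e (Sum.elim (fun i => u (z i)) y) := by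
  classical
  have hc : Fintype.card ((Set.range I)ᶜ : Set (Fin p)) = Fintype.card (Fin s) := by
    have h1 := Fintype.card_congr e
    rw [Fintype.card_compl_set, Set.card_range_of_injective hI]
    simp at h1 ⊢
    omega
  let σ : Fin r ⊕ Fin s ≃ Fin p :=
    (Equiv.sumCongr (Equiv.ofInjective I hI) (Fintype.equivOfCardEq hc).symm).trans
      (Equiv.Set.sumCompl (Set.range I))
  have hσ : ∀ i, σ (Sum.inl i) = I i := fun i => by simp [σ]
  let y : Fin s → Fin p → A := fun j => Pi.single (σ (Sum.inr j)) 1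
  let N : Matrix (Fin r ⊕ Fin s) (Fin r ⊕ Fin s) A :=
    Matrix.of fun b a => Sum.elim (fun i => u (z i)) y b (σ a)
  have h1 : N.det = imageMinor u z I := by
    have : N = Matrix.fromBlocks (Matrix.of fun b a => u (z b) (I a))
        (Matrix.of fun b a => u (z b) (σ (Sum.inr a))) 0 1 := by
      ext (b | b) (a | a)
      · simp [N, hσ]
      · simp [N]
      · simp [N, y]
      · simp [N, y, Pi.single_apply, Matrix.one_apply, eq_comm]
    rw [this, Matrix.det_fromBlocks_zero₂₁, Matrix.det_one, mul_one, imageMinor,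
      ← Matrix.det_transpose]
    rfl
  let τ : Equiv.Perm (Fin r ⊕ Fin s) := σ.trans e.symm
  have h2 : N = (Matrix.of fun b a => Sum.elim (fun i => u (z i)) y b (e a)).submatrix id τ := by
    ext b a
    simp [N, τ]
  exact ⟨_, y, by rw [← h1, h2, Matrix.det_permute', detForm_apply]⟩

namespace IsVolumeForm

variable {u : (Fin m → A) →ₗ[A] (Fin p → A)} {ω : (Fin m → A) [⋀^Fin r]→ₗ[A] A}

theorem degree_le [Nontrivial A] (h : IsVolumeForm u ω) : r ≤ p := by
  by_contra! hlt
  refine one_ne_zero (h.minor_faithful 1 fun z I => ?_)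
  rw [imageMinor_eq_zero, mul_zero]
  intro hI
  have := Fintype.card_le_of_injective I hI
  simp at this
  omega

/-- For fixed `y`, the form `x ↦ det (u x, y)` factors through the image of `u`, hence is `ω' y * ω
x`. Cancelling `ω` carries the properties of the determinant over to `ω'`. -/
theorem exists_next [Nontrivial A] (h : IsVolumeForm u ω)
    {u' : (Fin p → A) →ₗ[A] (Fin q → A)} (hu : Exact u u') :
    ∃ (s : ℕ) (ω' : (Fin p → A) [⋀^Fin s]→ₗ[A] A), IsVolumeForm u' ω' := by
  obtain ⟨s, hs⟩ := Nat.exists_eq_add_of_le h.degree_le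
  let e : Fin r ⊕ Fin s ≃ Fin p := finSumFinEquiv.trans (finCongr hs.symm)
  let D := detForm A e
  have h1 : ∀ y : Fin s → Fin p → A, ∃ c, ∀ x, D (Sum.elim (fun i => u (x i)) y) = c * ω x :=
    fun y => h.exists_eq_smul ((D.fixRight y).compLinearMap u) fun x i hi =>
      (D.fixRight y).map_coord_zero i hi
  choose f hf using h1
  let ω' : (Fin p → A) [⋀^Fin s]→ₗ[A] A :=
    { toFun := f
      map_update_add' := fun {_} y i a b => h.gradeTwo.eq_of_mul_eq fun x => by
        rw [← hf, add_mul, ← hf, ← hf]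
        have :=
          D.map_update_add (Sum.elim (fun i => u (x i)) y) (Sum.inr i) a b
        simpa only [Sum.update_elim_inr, smul_eq_mul] using this
      map_update_smul' := fun {_} y i a b => h.gradeTwo.eq_of_mul_eq fun x => by
        rw [← hf, smul_eq_mul, mul_assoc, ← hf]
        have :=
          D.map_update_smul (Sum.elim (fun i => u (x i)) y) (Sum.inr i) a b
        simpa only [Sum.update_elim_inr, smul_eq_mul] using this
      map_eq_zero_of_eq' := fun y i j hy hij => h.gradeTwo.1 _ fun x => by
        rw [← hf]
        exact D.map_eq_zero_of_eq _ (i := Sum.inr i) (j := Sum.inr j) hy (by simpa using hij) }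
  have hω' : ∀ y x, ω' y * ω x = D (Sum.elim (fun i => u (x i)) y) := fun y x => (hf y x).symm
  refine ⟨s, ω', ?_, ?_, ?_⟩
  · intro y i hi
    obtain ⟨w, hw⟩ := (hu _).1 hi
    -- One factor `ω x` turns `y i` into a combination of the `u (x j)`, which repeat arguments of
    -- the determinant; the other comes from `ω' y * ω x`.
    refine (h.gradeTwo_pow 2).1 _ fun x => ?_
    have h2 : ω x • y i = ∑ j, ω (update x j w) • u (x j) := by rw [← hw, h.cramer]
    have h3 : D (Sum.elim (fun i => u (x i)) (update y i (ω x • y i))) = 0 := by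
      rw [h2, ← Sum.update_elim_inr, AlternatingMap.map_update_sum]
      refine Finset.sum_eq_zero fun j _ => ?_
      rw [AlternatingMap.map_update_smul]
      have := D.map_update_self (Sum.elim (fun i => u (x i)) y) (i := Sum.inr i) (j := Sum.inl j)
        (by simp)
      rw [Sum.elim_inl] at this
      rw [this, smul_zero]
    rw [← Sum.update_elim_inr, AlternatingMap.map_update_smul, Sum.update_elim_inr,
      update_eq_self, ← hω', smul_eq_mul] at h3
    linear_combination h3
  · intro y w
    ext l
    refine h.gradeTwo.eq_of_mul_eq fun x => ?_
    -- Cramer's rule in `A ^ p`, pushed through `u'`: the terms in `u (x i)` vanish.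
    have h2 := congrFun (congrArg u' (detForm_cramer e (Sum.elim (fun i => u (x i)) y) w)) l
    rw [map_smul, Fintype.sum_sum_type, map_add, map_sum, map_sum] at h2
    simp only [map_smul, Sum.elim_inl, Sum.elim_inr,
      hu.apply_apply_eq_zero, smul_zero, Finset.sum_const_zero, zero_add,
      Sum.update_elim_inr] at h2
    have h3 : ∀ y, detForm A e (Sum.elim (fun i => u (x i)) y) = ω' y * ω x :=
      fun y => (hω' y x).symm
    simp only [h3, Finset.sum_apply, Pi.smul_apply, smul_eq_mul] at h2 ⊢
    rw [Finset.sum_mul]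
    refine Eq.trans (by ring) (h2.trans (Finset.sum_congr rfl fun j _ => by ring))
  · refine (h.minor_gradeTwo hu).mono fun i => ?_
    by_cases hI : Injective i.2
    · obtain ⟨c, y, hy⟩ := exists_detForm_eq e u i.1 hI
      change _ = c * D _ at hy
      rw [hy, ← hω']
      exact Ideal.mul_mem_left _ _ (Ideal.mul_mem_right _ _ (Ideal.subset_span ⟨y, rfl⟩))
    · rw [imageMinor_eq_zero hI]
      exact zero_mem _

end IsVolumeForm

end VolumeForm

/-! ### Ideals with a finite free resolution. -/

theorem FiniteFreeResolution.exists_isVolumeForm {A : Type*} [CommRing A] [Nontrivial A]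
    {M : Type*} [AddCommGroup M] [Module A M] {n : ℕ} (F : FiniteFreeResolution A M n) (j : ℕ) :
    ∀ k, n ≤ k + j → ∃ (s : ℕ) (ω : (Fin (F.r (k + 1)) → A) [⋀^Fin s]→ₗ[A] A),
      IsVolumeForm (F.u k) ω := by
  induction j with
  | zero =>
    intro k hk
    have h0 : F.r (k + 1) = 0 := F.r_eq_zero _ (by omega)
    have : IsEmpty (Fin (F.r (k + 1))) := by rw [h0]; infer_instance
    refine ⟨0, AlternatingMap.constOfIsEmpty A _ (Fin 0) 1, fun _ i => i.elim0, fun z w => ?_, ?_⟩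
    · simp [Subsingleton.elim w 0]
    · exact ⟨fun a ha => by simpa using ha 0, fun g _ => ⟨g 0, fun i => by
        simp [Subsingleton.elim i 0]⟩⟩
  | succ j ih =>
    intro k hk
    obtain ⟨s, ω, h⟩ := ih (k + 1) (by omega)
    exact h.exists_next (F.exact_succ k)

theorem IsFreelyResolvable.exists_gradeTwo {A : Type*} [CommRing A] {I : Ideal A}
    (hI : I ≠ ⊥) (h : IsFreelyResolvable A I) :
    ∃ g ∈ nonZeroDivisors A, (∀ x ∈ I, g ∣ x) ∧ GradeTwo ((↑) : idealDiv I g → A) := by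
  have : Nontrivial A := by
    by_contra hA
    rw [not_nontrivial_iff_subsingleton] at hA
    exact hI (Subsingleton.elim _ _)
  obtain ⟨n, ⟨F⟩⟩ := h
  let π : (Fin (F.r 0) → A) →ₗ[A] (Fin 1 → A) := LinearMap.pi fun _ => I.subtype ∘ₗ F.π
  have hπ : ∀ x i, π x i = F.π x := fun _ _ => rfl
  have hex : Exact (F.u 0) π := fun x => by
    rw [← F.exact_zero x]
    refine ⟨fun hx => Subtype.ext (congrFun hx 0), fun hx => ?_⟩
    ext i
    rw [hπ, hx]
    rfl
  obtain ⟨s, ω, h⟩ := F.exists_isVolumeForm n 0 (by omega)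
  obtain ⟨s, ω, h⟩ := h.exists_next hex
  have hs := h.degree_le
  interval_cases s
  -- In degree zero Cramer's sum is empty, so the values of `ω` annihilate `I`.
  · refine absurd ((Submodule.eq_bot_iff _).2 fun x hx => ?_) hI
    obtain ⟨w, hw⟩ := F.surjective ⟨x, hx⟩
    refine h.gradeTwo.1 x fun z => ?_
    have := congrFun (h.cramer z w) 0
    simpa [hπ, hw, mul_comm] using this
  · have hval : ∀ x z : Fin 1 → Fin (F.r 0) → A, ω x * F.π (z 0) = ω z * F.π (x 0) := by
      intro x z
      have h1 := congrFun (h.cramer x (z 0)) 0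
      have h2 : update x 0 (z 0) = z := by
        ext i : 1
        rw [Subsingleton.elim i 0, update_self]
      simpa [hπ, h2] using h1
    obtain ⟨g, hg⟩ := h.gradeTwo.2 (fun z => F.π (z 0)) hval
    -- The minors of order one of `π` are the values `g * ω z`, so an annihilator of `g` kills them
    -- all.
    refine ⟨g, mem_nonZeroDivisors_iff_right.2 fun x hx => h.minor_faithful x fun z J => ?_,
      fun x hx => ?_, h.gradeTwo.mono fun z => ?_⟩
    · rw [imageMinor, Matrix.det_fin_one, Matrix.of_apply, hπ, hg, ← mul_assoc, hx, zero_mul]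
    · obtain ⟨w, hw⟩ := F.surjective ⟨x, hx⟩
      exact ⟨ω fun _ => w, by rw [← hg, hw]⟩
    · rw [Subtype.range_coe]
      refine Ideal.subset_span ?_
      change g * ω z ∈ I
      rw [← hg]
      exact (F.π (z 0)).2

/-! ### Ideals with two generators. -/

section Pair

variable {A : Type*} [CommRing A]

theorem gradeTwo_pair_iff {b₁ b₂ : A} : GradeTwo ![b₁, b₂] ↔
    (∀ x, x * b₁ = 0 → x * b₂ = 0 → x = 0) ∧
      ∀ x y, b₁ * y = b₂ * x → ∃ c, x = c * b₁ ∧ y = c * b₂ := by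
  refine and_congr ?_ ⟨fun h x y hxy => ?_, fun h g hg => ?_⟩
  · simp [Fin.forall_fin_two]
  · obtain ⟨c, hc⟩ := h ![x, y] (by simp [Fin.forall_fin_two, hxy])
    exact ⟨c, hc 0, hc 1⟩
  · obtain ⟨c, h0, h1⟩ := h (g 0) (g 1) (hg 0 1)
    exact ⟨c, by simp [Fin.forall_fin_two, h0, h1]⟩

theorem idealDiv_span_pair {g : A} (hg : g ∈ nonZeroDivisors A) (b₁ b₂ : A) :
    idealDiv (Ideal.span {g * b₁, g * b₂}) g = Ideal.span {b₁, b₂} := by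
  ext x
  change g * x ∈ (Ideal.span {g * b₁, g * b₂} : Ideal A) ↔ x ∈ (Ideal.span {b₁, b₂} : Ideal A)
  simp only [Ideal.mem_span_pair]
  refine exists₂_congr fun c d => ?_
  rw [← mul_cancel_left_mem_nonZeroDivisors hg (x := c * b₁ + d * b₂) (y := x)]
  rw [show c * (g * b₁) + d * (g * b₂) = g * (c * b₁ + d * b₂) by ring]

theorem gradeTwo_pair_of_ideal {b₁ b₂ : A}
    (h : GradeTwo ((↑) : (Ideal.span {b₁, b₂} : Ideal A) → A)) : GradeTwo ![b₁, b₂] :=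
  h.mono fun i => by
    rw [Matrix.range_cons, Matrix.range_cons, Matrix.range_empty, Set.union_empty]
    exact i.2

/-- If `g * bᵢ = d * eᵢ`, then `d` is regular, so `e` is proportional to `b`, hence `e = c * b` and
`g = d * c`. -/
theorem isIdealGcd_of_gradeTwo {g b₁ b₂ : A} (hg : g ∈ nonZeroDivisors A)
    (h : GradeTwo ![b₁, b₂]) : IsIdealGcd (Ideal.span {g * b₁, g * b₂}) g := by
  rw [gradeTwo_pair_iff] at h
  refine ⟨fun x hx => ?_, fun d hd => ?_⟩
  · obtain ⟨c, c', rfl⟩ := Ideal.mem_span_pair.1 hx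
    exact ⟨c * b₁ + c' * b₂, by ring⟩
  · obtain ⟨e₁, h₁⟩ := hd (g * b₁) (Ideal.subset_span (by simp))
    obtain ⟨e₂, h₂⟩ := hd (g * b₂) (Ideal.subset_span (by simp))
    have hg' := mem_nonZeroDivisors_iff_right.1 hg
    have hdreg : ∀ x, x * d = 0 → x = 0 := fun x hx => h.1 x
      (hg' _ (by linear_combination x * h₁ + e₁ * hx))
      (hg' _ (by linear_combination x * h₂ + e₂ * hx))
    obtain ⟨c, hc₁, hc₂⟩ := h.2 e₁ e₂ (sub_eq_zero.1 (hdreg _ (by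
      linear_combination b₂ * h₁ - b₁ * h₂)))
    refine ⟨c, sub_eq_zero.1 (h.1 _ ?_ ?_)⟩
    · linear_combination h₁ + d * hc₁
    · linear_combination h₂ + d * hc₂

theorem rowMap_apply (a₁ a₂ : A) (v : Fin 2 → A) :
    (rowMap a₁ a₂ v : A) = v 0 * a₁ + v 1 * a₂ := by
  simp [rowMap, Fintype.linearCombination_apply, Fin.sum_univ_two]

theorem rowMap_surjective (a₁ a₂ : A) : Surjective (rowMap a₁ a₂) := fun x => by
  obtain ⟨c, d, h⟩ := Ideal.mem_span_pair.1 x.2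
  exact ⟨![c, d], Subtype.ext (by simpa [rowMap_apply] using h)⟩

theorem exact_columnMap_rowMap {g b₁ b₂ : A} (hg : g ∈ nonZeroDivisors A)
    (h : GradeTwo ![b₁, b₂]) :
    Submodule.annihilator (Ideal.span {g * b₁, g * b₂} : Ideal A) = ⊥ ∧
      ∃ c₁ c₂ : A, Injective (columnMap c₁ c₂) ∧
        Exact (columnMap c₁ c₂) (rowMap (g * b₁) (g * b₂)) ∧
        Surjective (rowMap (g * b₁) (g * b₂)) := by
  rw [gradeTwo_pair_iff] at h
  have hg' := mem_nonZeroDivisors_iff_right.1 hg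
  refine ⟨(Submodule.eq_bot_iff _).2 fun x hx => ?_, b₂, -b₁, ?_, fun v => ?_,
    rowMap_surjective _ _⟩
  · rw [Submodule.mem_annihilator] at hx
    refine h.1 x (hg' _ ?_) (hg' _ ?_)
    · have := hx (g * b₁) (Ideal.subset_span (by simp))
      rw [smul_eq_mul] at this
      linear_combination this
    · have := hx (g * b₂) (Ideal.subset_span (by simp))
      rw [smul_eq_mul] at this
      linear_combination this
  · refine (injective_iff_map_eq_zero _).2 fun x hx => h.1 x ?_ ?_
    · simpa [columnMap] using congrFun hx 1
    · simpa [columnMap] using congrFun hx 0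
  · rw [← Subtype.coe_inj, rowMap_apply]
    refine ⟨fun hv => ?_, ?_⟩
    · obtain ⟨c, h0, h1⟩ := h.2 (-v 1) (v 0) (sub_eq_zero.1 (hg' _ (by
        rw [ZeroMemClass.coe_zero] at hv
        linear_combination hv)))
      refine ⟨c, ?_⟩
      ext i
      fin_cases i
      · simp [columnMap, h1]
      · simp [columnMap, ← h0]
    · rintro ⟨c, rfl⟩
      simp [columnMap]
      ring

theorem isFreelyResolvable_of_exact {a₁ a₂ b₁ b₂ : A} (h₁ : Injective (columnMap b₁ b₂))
    (h₂ : Exact (columnMap b₁ b₂) (rowMap a₁ a₂)) :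
    IsFreelyResolvable A (Ideal.span {a₁, a₂} : Ideal A) := by
  let r : ℕ → ℕ := fun k => match k with
    | 0 => 2
    | 1 => 1
    | _ + 2 => 0
  let u : ∀ k, (Fin (r (k + 1)) → A) →ₗ[A] (Fin (r k) → A) := fun k => match k with
    | 0 => columnMap b₁ b₂ ∘ₗ LinearMap.proj (0 : Fin 1)
    | _ + 1 => 0
  refine ⟨1, ⟨r, fun k hk => ?_, u, rowMap a₁ a₂, rowMap_surjective _ _, fun v => ?_, fun k => ?_⟩⟩
  · obtain ⟨k, rfl⟩ := Nat.exists_eq_add_of_le' hk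
    rfl
  · rw [h₂ v]
    exact ⟨fun ⟨c, hc⟩ => ⟨fun _ => c, hc⟩, fun ⟨c, hc⟩ => ⟨c 0, hc⟩⟩
  · cases k with
    | zero =>
      intro v
      refine ⟨fun hv => ⟨0, ?_⟩, ?_⟩
      · have h0 : v (0 : Fin 1) = 0 := h₁ (hv.trans (map_zero _).symm)
        ext i
        change 0 = v i
        rw [← h0]
        exact congrArg v (Subsingleton.elim (α := Fin 1) _ _)
      · rintro ⟨w, rfl⟩
        exact (u 0).map_zero
    | succ k =>
      intro v
      exact ⟨fun _ => ⟨0, funext fun i => i.elim0⟩, fun _ => rfl⟩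

theorem isFreelyResolvable_bot : IsFreelyResolvable A (⊥ : Ideal A) :=
  ⟨0, ⟨fun _ => 0, fun _ _ => rfl, fun _ => 0, 0, fun _ => ⟨0, Subsingleton.elim _ _⟩,
    fun _ => ⟨fun _ => ⟨0, Subsingleton.elim _ _⟩, fun _ => rfl⟩,
    fun _ _ => ⟨fun _ => ⟨0, Subsingleton.elim _ _⟩, fun _ => rfl⟩⟩⟩

/-- Dividing by the gcd leaves a relatively prime pair, to which Euclid's lemma applies. -/
theorem IsIntegralGcdRing.exists_gradeTwo (hA : IsIntegralGcdRing A) {a₁ a₂ : A}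
    (h : (Ideal.span {a₁, a₂} : Ideal A) ≠ ⊥) :
    ∃ g ∈ nonZeroDivisors A, ∃ b₁ b₂, a₁ = g * b₁ ∧ a₂ = g * b₂ ∧ GradeTwo ![b₁, b₂] := by
  classical
  have : Nontrivial A := by
    by_contra hA
    rw [not_nontrivial_iff_subsingleton] at hA
    exact h (Subsingleton.elim _ _)
  have : NoZeroDivisors A := ⟨fun {a b} hab => (hA.1 b).symm.imp
    (fun hb => mem_nonZeroDivisors_iff_right.1 hb a hab) id⟩
  have : IsDomain A := NoZeroDivisors.to_isDomain A
  let _ : GCDMonoid A := gcdMonoidOfExistsGCD fun a b => by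
    obtain ⟨g, hga, hgb, hg⟩ := hA.2 a b
    exact ⟨g, fun d => ⟨fun hd => hg d hd.1 hd.2, fun hd => ⟨hd.trans hga, hd.trans hgb⟩⟩⟩
  have hne : ¬ (a₁ = 0 ∧ a₂ = 0) := fun ⟨h₁, h₂⟩ => h (by simp [h₁, h₂])
  obtain ⟨b₁, b₂, h₁, h₂, hu⟩ := extract_gcd a₁ a₂
  have hg : gcd a₁ a₂ ≠ 0 := fun h0 => hne (by rwa [gcd_eq_zero_iff] at h0)
  refine ⟨gcd a₁ a₂, mem_nonZeroDivisors_of_ne_zero hg, b₁, b₂, h₁, h₂, gradeTwo_pair_iff.2 ?_⟩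
  have hb : b₁ ≠ 0 ∨ b₂ ≠ 0 := by
    by_contra! H
    exact hne ⟨by rw [h₁, H.1, mul_zero], by rw [h₂, H.2, mul_zero]⟩
  have hrel : IsRelPrime b₁ b₂ := gcd_isUnit_iff_isRelPrime.1 hu
  refine ⟨fun x hx₁ hx₂ => ?_, fun x y hxy => ?_⟩
  · rcases hb with hb | hb
    · exact (mul_eq_zero.1 hx₁).resolve_right hb
    · exact (mul_eq_zero.1 hx₂).resolve_right hb
  · rcases hb with hb | hb
    · obtain ⟨c, rfl⟩ := hrel.dvd_of_dvd_mul_left (Dvd.intro _ hxy)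
      exact ⟨c, mul_comm _ _, mul_left_cancel₀ hb (by rw [hxy]; ring)⟩
    · obtain ⟨c, rfl⟩ := hrel.symm.dvd_of_dvd_mul_left (Dvd.intro _ hxy.symm)
      exact ⟨c, mul_left_cancel₀ hb (by rw [← hxy]; ring), mul_comm _ _⟩

end Pair

theorem isWeaklyRegular_pair_iff {R : Type*} [CommRing R] (a b : R) :
    RingTheory.Sequence.IsWeaklyRegular R [a, b] ↔
      (∀ x, a * x = 0 → x = 0) ∧ ∀ x y, b * x = a * y → ∃ z, x = a * z := by
  rw [RingTheory.Sequence.isWeaklyRegular_cons_iff,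
    RingTheory.Sequence.isWeaklyRegular_singleton_iff, isSMulRegular_iff_right_eq_zero_of_smul,
    isSMulRegular_quotient_iff_mem_of_smul_mem]
  simp only [Submodule.mem_smul_pointwise_iff_exists, smul_eq_mul, Submodule.mem_top, true_and]
  refine and_congr Iff.rfl ⟨fun h x y hxy => ?_, fun h x => ?_⟩
  · obtain ⟨z, hz⟩ := h x ⟨y, hxy.symm⟩
    exact ⟨z, hz.symm⟩
  · rintro ⟨y, hy⟩
    obtain ⟨z, hz⟩ := h x y hy.symm
    exact ⟨z, hz.symm⟩

/-! ### Comparison with Kronecker sequences. -/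

section TrueGrade

open MvPolynomial

variable {A : Type*} [CommRing A]

theorem coeff_mul_const {σ : Type*} (p : MvPolynomial σ A) (a : A) (m : σ →₀ ℕ) :
    coeff m (p * C a) = coeff m p * a := by
  rw [mul_comm, coeff_C_mul, mul_comm]

theorem coeff_mem_span_coeffs {σ : Type*} (p : MvPolynomial σ A) (m : σ →₀ ℕ) :
    coeff m p ∈ Ideal.span (p.coeffs : Set A) := by
  by_cases h : coeff m p = 0
  · rw [h]
    exact zero_mem _
  · exact Ideal.subset_span (coeff_mem_coeffs m h)

/-- The endomorphism of the polynomial ring that kills the indeterminates outside of `s`. -/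
noncomputable def restrictVars {σ : Type*} [DecidableEq σ] (s : Finset σ) :
    MvPolynomial σ A →ₐ[A] MvPolynomial σ A :=
  aeval fun i => if i ∈ s then X i else 0

theorem restrictVars_eq_self {σ : Type*} [DecidableEq σ] {s : Finset σ} {p : MvPolynomial σ A}
    (h : p.vars ⊆ s) : restrictVars s p = p :=
  hom_congr_vars (f₁ := (restrictVars s : MvPolynomial σ A →ₐ[A] _).toRingHom)
    (f₂ := RingHom.id _) (by ext; simp)
    (fun i hi _ => by simp [restrictVars, h hi]) rfl

theorem restrictVars_comp {σ : Type*} [DecidableEq σ] {s t : Finset σ} (h : Disjoint s t)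
    (p : MvPolynomial σ A) : restrictVars t (restrictVars s p) = C (constantCoeff p) := by
  have : (restrictVars t : MvPolynomial σ A →ₐ[A] _).toRingHom.comp
      (restrictVars s : MvPolynomial σ A →ₐ[A] _).toRingHom =
      (C : A →+* MvPolynomial σ A).comp constantCoeff := by
    ext i
    · simp
    · by_cases hi : i ∈ s
      · simp [restrictVars, hi, Finset.disjoint_left.1 h hi]
      · simp [restrictVars, hi]
  exact DFunLike.congr_fun this p

/-- Applying `g` to the coefficients of `f i` gives `φ i` with `f 1 * φ 0 = f 0 * φ 1`. Regularity
yields a common quotient `p`, which disjointness of the variables reduces to a constant. -/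
theorem TrueGradeGE.gradeTwo {I : Ideal A} (h : TrueGradeGE I 2) :
    GradeTwo ((↑) : I → A) := by
  classical
  obtain ⟨f, ⟨hspan, hdisj⟩, hreg⟩ := h
  rw [List.ofFn_succ, List.ofFn_succ, List.ofFn_zero, isWeaklyRegular_pair_iff] at hreg
  change (∀ x, f 0 * x = 0 → x = 0) ∧ ∀ x y, f 1 * x = f 0 * y → ∃ z, x = f 0 * z at hreg
  obtain ⟨hreg₀, hreg₁⟩ := hreg
  have hmem : ∀ i m, coeff m (f i) ∈ I := fun i m => hspan i ▸ coeff_mem_span_coeffs (f i) m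
  have faithful : ∀ a : A, (∀ x : I, a * x = 0) → a = 0 := by
    intro a ha
    have := hreg₀ (C a) (by
      ext m
      rw [mul_comm, coeff_C_mul, ha ⟨_, hmem 0 m⟩, coeff_zero])
    simpa using this
  refine ⟨faithful, fun g hg => ?_⟩
  let g' : A → A := fun x => if h : x ∈ I then g ⟨x, h⟩ else 0
  have hg' : ∀ x : I, g' x = g x := fun x => by simp [g']
  have hcomm : ∀ x ∈ I, ∀ y ∈ I, x * g' y = y * g' x := fun x hx y hy => by
    simpa [g', hx, hy] using hg ⟨x, hx⟩ ⟨y, hy⟩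
  let φ : Fin 2 → MvPolynomial ℕ A := fun i =>
    ∑ m ∈ (f i).support, monomial m (g' (coeff m (f i)))
  have hvars : ∀ i, (φ i).vars ⊆ (f i).vars := fun i k hk => by
    obtain ⟨m, hm, hkm⟩ := (mem_vars_iff_mem_support k).1 hk
    refine (mem_vars_iff_mem_support k).2 ⟨m, ?_, hkm⟩
    by_contra hm'
    refine mem_support_iff.1 hm ?_
    simp only [φ, coeff_sum, coeff_monomial]
    rw [Finset.sum_ite_eq', if_neg hm']
  have hprod : f 1 * φ 0 = f 0 * φ 1 := by
    conv_lhs => rw [(f 1).as_sum]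
    conv_rhs => rw [(f 0).as_sum]
    simp only [φ, Finset.sum_mul_sum, monomial_mul]
    rw [Finset.sum_comm]
    refine Finset.sum_congr rfl fun m _ => Finset.sum_congr rfl fun n _ => ?_
    rw [add_comm, hcomm _ (hmem 1 n) _ (hmem 0 m)]
  obtain ⟨p, hp⟩ := hreg₁ _ _ hprod
  have hp₁ : φ 1 = f 1 * p := sub_eq_zero.1 (hreg₀ _ (by
    rw [mul_sub, ← hprod, hp]; ring))
  -- Killing the variables foreign to `f 0` fixes `f 0` and `φ 0`, hence `p`. Killing afterwards
  -- those foreign to `f 1` leaves only the constant term of `p`.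
  have hp₀ : restrictVars (f 0).vars p = p := by
    have := congrArg (restrictVars (f 0).vars) hp
    rw [map_mul, restrictVars_eq_self (hvars 0), restrictVars_eq_self subset_rfl, hp] at this
    exact (sub_eq_zero.1 (hreg₀ _ (by rw [mul_sub, this, sub_self]))).symm
  set c := constantCoeff p
  have hp₂ : φ 1 = f 1 * C c := by
    have := congrArg (restrictVars (f 1).vars) hp₁
    rwa [map_mul, restrictVars_eq_self (hvars 1), restrictVars_eq_self subset_rfl, ← hp₀,
      restrictVars_comp (hdisj 0 1 (by simp))] at this
  have hc : ∀ m ∈ (f 1).support, g' (coeff m (f 1)) = c * coeff m (f 1) := fun m hm => by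
    have := congrArg (coeff m) hp₂
    rw [mul_comm, coeff_C_mul] at this
    rw [← this]
    simp only [φ, coeff_sum, coeff_monomial]
    rw [Finset.sum_ite_eq', if_pos hm]
  refine ⟨c, fun x => sub_eq_zero.1 (faithful _ fun y => ?_)⟩
  have hy : (y : A) ∈ Ideal.span ((f 1).coeffs : Set A) := by rw [hspan]; exact y.2
  have hle : Ideal.span ((f 1).coeffs : Set A) ≤
      Submodule.comap (LinearMap.mulLeft A (g x - c * x)) ⊥ := by
    refine Ideal.span_le.2 fun a ha => ?_
    obtain ⟨m, hm, rfl⟩ := mem_coeffs_iff.1 ha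
    have h1 := hcomm _ (hmem 1 m) x x.2
    rw [hc m hm, hg'] at h1
    change (g x - c * x) * coeff m (f 1) = 0
    linear_combination h1
  exact hle hy

/-- McCoy's theorem: a zero divisor among polynomials is killed by a nonzero constant. -/
theorem Polynomial.eq_zero_of_linear_mul_eq_zero {S : Type*} [CommRing S] {b₁ b₂ : S}
    (h : ∀ x, x * b₁ = 0 → x * b₂ = 0 → x = 0) {P : Polynomial S}
    (hP : (Polynomial.C b₁ + Polynomial.C b₂ * Polynomial.X) * P = 0) : P = 0 := by
  have hmem : Polynomial.C b₁ + Polynomial.C b₂ * Polynomial.X ∈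
      nonZeroDivisors (Polynomial S) := by
    by_contra hn
    obtain ⟨a, ha, ha'⟩ := Polynomial.notMem_nonZeroDivisors_iff.1 hn
    refine ha (h a ?_ ?_)
    · simpa using congrArg (fun Q => Polynomial.coeff Q 0) ha'
    · simpa [Polynomial.coeff_C] using congrArg (fun Q => Polynomial.coeff Q 1) ha'
  exact mem_nonZeroDivisors_iff_left.1 hmem P hP

/-- Polynomials in countably many indeterminates as polynomials in the first one. -/
noncomputable def splitFirstVar (A : Type*) [CommRing A] :
    MvPolynomial ℕ A ≃ₐ[A] Polynomial (MvPolynomial ℕ A) :=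
  (renameEquiv A
    { toFun := fun n : ℕ => (n.casesOn none some : Option ℕ)
      invFun := fun o => o.elim 0 Nat.succ
      left_inv := fun n => by cases n <;> rfl
      right_inv := fun o => by cases o <;> rfl }).trans (optionEquivLeft A ℕ)

theorem splitFirstVar_C (a : A) : splitFirstVar A (C a) = Polynomial.C (C a) := by
  simp [splitFirstVar]

theorem splitFirstVar_X_zero : splitFirstVar A (X 0) = Polynomial.X := by
  simp [splitFirstVar]

theorem splitFirstVar_X_succ (n : ℕ) : splitFirstVar A (X (n + 1)) = Polynomial.C (X n) := by
  simp [splitFirstVar]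

/-- The polynomial `b₁ + b₂ Xₖ`. -/
noncomputable def linearPoly (b₁ b₂ : A) (k : ℕ) : MvPolynomial ℕ A := C b₁ + C b₂ * X k

theorem span_coeffs_linearPoly (b₁ b₂ : A) (k : ℕ) :
    Ideal.span ((linearPoly b₁ b₂ k).coeffs : Set A) = Ideal.span {b₁, b₂} := by
  classical
  have hcoeff : ∀ m, coeff m (linearPoly b₁ b₂ k) =
      (if 0 = m then b₁ else 0) + b₂ * if Finsupp.single k 1 = m then 1 else 0 := fun m => by
    rw [linearPoly, coeff_add, coeff_C, coeff_C_mul, coeff_X]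
  refine le_antisymm (Ideal.span_le.2 fun a ha => ?_) (Ideal.span_le.2 ?_)
  · obtain ⟨m, -, rfl⟩ := mem_coeffs_iff.1 ha
    rw [hcoeff]
    refine add_mem ?_ (Ideal.mul_mem_right _ _ (Ideal.subset_span (by simp)))
    split_ifs
    · exact Ideal.subset_span (by simp)
    · exact zero_mem _
  · have h0 : Finsupp.single k 1 ≠ (0 : ℕ →₀ ℕ) := by simp
    refine Set.insert_subset ?_ (Set.singleton_subset_iff.2 ?_)
    · have := coeff_mem_span_coeffs (linearPoly b₁ b₂ k) 0
      rwa [hcoeff, if_pos rfl, if_neg h0, mul_zero, add_zero] at this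
    · have := coeff_mem_span_coeffs (linearPoly b₁ b₂ k) (Finsupp.single k 1)
      rwa [hcoeff, if_pos rfl, if_neg h0.symm, mul_one, zero_add] at this

theorem vars_linearPoly_subset (b₁ b₂ : A) (k : ℕ) : (linearPoly b₁ b₂ k).vars ⊆ {k} := by
  classical
  rcases subsingleton_or_nontrivial A with _ | _
  · rw [Subsingleton.elim (linearPoly b₁ b₂ k) 0, vars_0]
    exact Finset.empty_subset _
  · refine (vars_add_subset _ _).trans (Finset.union_subset (by simp) ((vars_mul _ _).trans ?_))
    simp

theorem linearPoly_mul_eq_zero {b₁ b₂ : A} (h : ∀ x, x * b₁ = 0 → x * b₂ = 0 → x = 0)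
    {P : MvPolynomial ℕ A} (hP : linearPoly b₁ b₂ 0 * P = 0) : P = 0 := by
  have := congrArg (splitFirstVar A) hP
  rw [linearPoly, map_mul, map_add, map_mul, splitFirstVar_C, splitFirstVar_C,
    splitFirstVar_X_zero, map_zero] at this
  refine (map_eq_zero_iff _ (splitFirstVar A).injective).1
    (Polynomial.eq_zero_of_linear_mul_eq_zero (fun x h₁ h₂ => ?_) this)
  ext m
  refine h _ ?_ ?_
  · simpa [coeff_mul_const] using congrArg (coeff m) h₁
  · simpa [coeff_mul_const] using congrArg (coeff m) h₂

/-- The cofactors `P`, `Q` are proportional to `b₁`, `b₂` coefficient by coefficient, so they are `S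
* b₁`, `S * b₂`; then `b₁` and `b₂` both kill `c - linearPoly b₁ b₂ 0 * S`. -/
theorem dvd_of_linearPoly_dvd {b₁ b₂ : A} (h : GradeTwo ![b₁, b₂]) {c : MvPolynomial ℕ A}
    (h₁ : linearPoly b₁ b₂ 0 ∣ c * C b₁) (h₂ : linearPoly b₁ b₂ 0 ∣ c * C b₂) :
    linearPoly b₁ b₂ 0 ∣ c := by
  classical
  rw [gradeTwo_pair_iff] at h
  obtain ⟨P, hP⟩ := h₁
  obtain ⟨Q, hQ⟩ := h₂
  have hPQ : C b₁ * Q = C b₂ * P := sub_eq_zero.1 (linearPoly_mul_eq_zero h.1 (by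
    linear_combination C b₂ * hP - C b₁ * hQ))
  choose s hs₁ hs₂ using fun m => h.2 (coeff m P) (coeff m Q) (by
    simpa [coeff_C_mul] using congrArg (coeff m) hPQ)
  let S : MvPolynomial ℕ A := ∑ m ∈ P.support ∪ Q.support, monomial m (s m)
  have hS : ∀ m, coeff m S = if m ∈ P.support ∪ Q.support then s m else 0 := fun m => by
    simp only [S, coeff_sum, coeff_monomial]
    rw [Finset.sum_ite_eq']
  have hPS : P = S * C b₁ := by
    ext m
    rw [coeff_mul_const, hS]
    split_ifs with hm
    · exact hs₁ m
    · rw [zero_mul]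
      exact notMem_support_iff.1 fun h => hm (Finset.mem_union_left _ h)
  have hQS : Q = S * C b₂ := by
    ext m
    rw [coeff_mul_const, hS]
    split_ifs with hm
    · exact hs₂ m
    · rw [zero_mul]
      exact notMem_support_iff.1 fun h => hm (Finset.mem_union_right _ h)
  refine ⟨S, sub_eq_zero.1 ?_⟩
  ext m
  refine h.1 _ ?_ ?_
  · rw [← coeff_mul_const, sub_mul, hP, hPS, ← mul_assoc, sub_self, coeff_zero]
  · rw [← coeff_mul_const, sub_mul, hQ, hQS, ← mul_assoc, sub_self, coeff_zero]

theorem GradeTwo.trueGradeGE {b₁ b₂ : A} (h : GradeTwo ![b₁, b₂]) :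
    TrueGradeGE (Ideal.span {b₁, b₂}) 2 := by
  have hpair := gradeTwo_pair_iff.1 h
  -- In this order, `splitFirstVar` makes the first term a constant and the second linear, so
  -- McCoy's theorem applies modulo the first.
  refine ⟨![linearPoly b₁ b₂ 1, linearPoly b₁ b₂ 0], ⟨?_, ?_⟩, ?_⟩
  · simp [Fin.forall_fin_two, span_coeffs_linearPoly]
  · have hd : Disjoint (linearPoly b₁ b₂ 1).vars (linearPoly b₁ b₂ 0).vars :=
      Finset.disjoint_of_subset_left (vars_linearPoly_subset _ _ _)
        (Finset.disjoint_of_subset_right (vars_linearPoly_subset _ _ _) (by simp))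
    simp [Fin.forall_fin_two, hd, hd.symm]
  · rw [List.ofFn_succ, List.ofFn_succ, List.ofFn_zero]
    change RingTheory.Sequence.IsWeaklyRegular _ [linearPoly b₁ b₂ 1, linearPoly b₁ b₂ 0]
    have hΦ₁ : splitFirstVar A (linearPoly b₁ b₂ 1) = Polynomial.C (linearPoly b₁ b₂ 0) := by
      simp only [linearPoly, map_add, map_mul, splitFirstVar_C]
      rw [splitFirstVar_X_succ 0]
    have hΦ₀ : splitFirstVar A (linearPoly b₁ b₂ 0) =
        Polynomial.C (C b₁) + Polynomial.C (C b₂) * Polynomial.X := by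
      simp only [linearPoly, map_add, map_mul, splitFirstVar_C, splitFirstVar_X_zero]
    refine (isWeaklyRegular_pair_iff _ _).2 ⟨fun x hx => ?_, fun x y hxy => ?_⟩
    · have hx' := congrArg (splitFirstVar A) hx
      rw [map_mul, hΦ₁, map_zero] at hx'
      refine (map_eq_zero_iff _ (splitFirstVar A).injective).1 ?_
      ext1 n
      refine linearPoly_mul_eq_zero hpair.1 ?_
      simpa using congrArg (fun P => Polynomial.coeff P n) hx'
    · have hxy' := congrArg (splitFirstVar A) hxy
      rw [map_mul, map_mul, hΦ₁, hΦ₀] at hxy'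
      let J : Ideal (MvPolynomial ℕ A) := Ideal.span {linearPoly b₁ b₂ 0}
      have hmk : Ideal.Quotient.mk J (linearPoly b₁ b₂ 0) = 0 :=
        Ideal.Quotient.eq_zero_iff_mem.2 (Ideal.mem_span_singleton_self _)
      have hz : Polynomial.map (Ideal.Quotient.mk J) (splitFirstVar A x) = 0 := by
        refine Polynomial.eq_zero_of_linear_mul_eq_zero (b₁ := Ideal.Quotient.mk J (C b₁))
          (b₂ := Ideal.Quotient.mk J (C b₂)) (fun c h₁ h₂ => ?_) ?_
        · obtain ⟨c, rfl⟩ := Ideal.Quotient.mk_surjective c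
          rw [← map_mul, Ideal.Quotient.eq_zero_iff_mem, Ideal.mem_span_singleton] at h₁ h₂
          rw [Ideal.Quotient.eq_zero_iff_mem, Ideal.mem_span_singleton]
          exact dvd_of_linearPoly_dvd h h₁ h₂
        · have := congrArg (Polynomial.map (Ideal.Quotient.mk J)) hxy'
          simpa [hmk] using this
      have hdvd : Polynomial.C (linearPoly b₁ b₂ 0) ∣ splitFirstVar A x :=
        Polynomial.C_dvd_iff_dvd_coeff _ _ |>.2 fun n => by
          have := congrArg (fun P => Polynomial.coeff P n) hz
          rw [Polynomial.coeff_map, Polynomial.coeff_zero, Ideal.Quotient.eq_zero_iff_mem,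
            Ideal.mem_span_singleton] at this
          exact this
      rw [← hΦ₁] at hdvd
      exact (map_dvd_iff (splitFirstVar A)).1 hdvd

end TrueGrade

/-! ### The two equivalences. -/

theorem mainTheorem5 {A : Type*} [CommRing A] :
    (∀ a₁ a₂ : A, (Ideal.span {a₁, a₂} : Ideal A) ≠ ⊥ →
      List.TFAE [
        ∃ g ∈ nonZeroDivisors A, IsIdealGcd (Ideal.span {a₁, a₂}) g ∧
          TrueGradeGE (idealDiv (Ideal.span {a₁, a₂}) g) 2,
        IsFreelyResolvable A (Ideal.span {a₁, a₂} : Ideal A),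
        Submodule.annihilator (Ideal.span {a₁, a₂} : Ideal A) = ⊥ ∧
          ∃ b₁ b₂ : A, Function.Injective (columnMap b₁ b₂) ∧
            Function.Exact (columnMap b₁ b₂) (rowMap a₁ a₂) ∧
            Function.Surjective (rowMap a₁ a₂)]) ∧
    ((∀ a₁ a₂ : A, IsFreelyResolvable A (Ideal.span {a₁, a₂} : Ideal A)) ↔
      IsIntegralGcdRing A) := by
  have exists_of_ideal : ∀ {a₁ a₂ g : A}, g ∈ nonZeroDivisors A →
      (∀ x ∈ (Ideal.span {a₁, a₂} : Ideal A), g ∣ x) →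
      GradeTwo ((↑) : idealDiv (Ideal.span {a₁, a₂}) g → A) →
      ∃ b₁ b₂, a₁ = g * b₁ ∧ a₂ = g * b₂ ∧ GradeTwo ![b₁, b₂] := by
    intro a₁ a₂ g hg hdvd h
    obtain ⟨b₁, rfl⟩ := hdvd a₁ (Ideal.subset_span (by simp))
    obtain ⟨b₂, rfl⟩ := hdvd a₂ (Ideal.subset_span (by simp))
    rw [idealDiv_span_pair hg] at h
    exact ⟨b₁, b₂, rfl, rfl, gradeTwo_pair_of_ideal h⟩
  -- A fourth condition, the factorization through a pair of grade two, links the other three.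
  have tfae : ∀ a₁ a₂ : A, (Ideal.span {a₁, a₂} : Ideal A) ≠ ⊥ →
      List.TFAE [
        ∃ g ∈ nonZeroDivisors A, IsIdealGcd (Ideal.span {a₁, a₂}) g ∧
          TrueGradeGE (idealDiv (Ideal.span {a₁, a₂}) g) 2,
        IsFreelyResolvable A (Ideal.span {a₁, a₂} : Ideal A),
        Submodule.annihilator (Ideal.span {a₁, a₂} : Ideal A) = ⊥ ∧
          ∃ b₁ b₂ : A, Injective (columnMap b₁ b₂) ∧
            Exact (columnMap b₁ b₂) (rowMap a₁ a₂) ∧ Surjective (rowMap a₁ a₂),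
        ∃ g ∈ nonZeroDivisors A, ∃ b₁ b₂, a₁ = g * b₁ ∧ a₂ = g * b₂ ∧ GradeTwo ![b₁, b₂]] := by
    intro a₁ a₂ hne
    tfae_have 1 → 4 := fun ⟨g, hg, hgcd, hgr⟩ =>
      ⟨g, hg, exists_of_ideal hg hgcd.1 hgr.gradeTwo⟩
    tfae_have 4 → 1 := by
      rintro ⟨g, hg, b₁, b₂, rfl, rfl, h⟩
      exact ⟨g, hg, isIdealGcd_of_gradeTwo hg h, by
        rw [idealDiv_span_pair hg]; exact h.trueGradeGE⟩
    tfae_have 4 → 3 := by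
      rintro ⟨g, hg, b₁, b₂, rfl, rfl, h⟩
      exact exact_columnMap_rowMap hg h
    tfae_have 3 → 2 := fun ⟨_, b₁, b₂, h₁, h₂, _⟩ => isFreelyResolvable_of_exact h₁ h₂
    tfae_have 2 → 4 := fun h => by
      obtain ⟨g, hg, hdvd, hgr⟩ := h.exists_gradeTwo hne
      exact ⟨g, hg, exists_of_ideal hg hdvd hgr⟩
    tfae_finish
  refine ⟨fun a₁ a₂ hne => ?_, fun h => ⟨fun a => ?_, fun a b => ?_⟩, fun h a₁ a₂ => ?_⟩
  · have h := tfae a₁ a₂ hne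
    tfae_have 1 ↔ 2 := h.out 0 1
    tfae_have 2 ↔ 3 := h.out 1 2
    tfae_finish
  · by_cases ha : a = 0
    · exact Or.inl ha
    · right
      -- For the pair `a, 0` the factorization forces `b₂ = 0`, so `b₁` alone is regular, and so is
      -- `a = g * b₁`.
      have hne : (Ideal.span {a, 0} : Ideal A) ≠ ⊥ := fun h0 => ha (by
        have : a ∈ (Ideal.span {a, 0} : Ideal A) := Ideal.subset_span (by simp)
        simpa [h0] using this)
      obtain ⟨g, hg, b₁, b₂, h₁, h₂, hb⟩ := ((tfae a 0 hne).out 1 3).1 (h a 0)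
      have hb₂ : b₂ = 0 := mem_nonZeroDivisors_iff_left.1 hg _ h₂.symm
      refine mem_nonZeroDivisors_iff_right.2 fun x hx => (gradeTwo_pair_iff.1 hb).1 x ?_ ?_
      · refine mem_nonZeroDivisors_iff_right.1 hg _ ?_
        rw [mul_assoc, mul_comm b₁, ← h₁, hx]
      · rw [hb₂, mul_zero]
  · by_cases hne : (Ideal.span {a, b} : Ideal A) = ⊥
    · rw [Ideal.span_eq_bot] at hne
      have ha := hne a (by simp)
      have hb := hne b (by simp)
      exact ⟨0, by simp [ha], by simp [hb], fun d _ _ => dvd_zero d⟩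
    · obtain ⟨g, -, hgcd, -⟩ := ((tfae a b hne).out 0 1).2 (h a b)
      refine ⟨g, hgcd.1 a (Ideal.subset_span (by simp)), hgcd.1 b (Ideal.subset_span (by simp)),
        fun d hda hdb => hgcd.2 d fun x hx => ?_⟩
      obtain ⟨c, e, rfl⟩ := Ideal.mem_span_pair.1 hx
      exact dvd_add (hda.mul_left c) (hdb.mul_left e)
  · by_cases hne : (Ideal.span {a₁, a₂} : Ideal A) = ⊥
    · rw [hne]
      exact isFreelyResolvable_bot
    · exact ((tfae a₁ a₂ hne).out 1 3).2 (h.exists_gradeTwo hne)
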